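/- Let $R$ be a commutative noetherian ring, and let all modules be finitely generated. For a module $M$, choose an exact sequence $P_1\xrightarrow{d}P_0\to M\to 0$ with $P_0,P_1$ finitely generated projective, and let $\operatorname{Tr}M$ be the cokernel of $\operatorname{Hom}_R(d,R)\colon\operatorname{Hom}_R(P_0,R)\to\operatorname{Hom}_R(P_1,R)$; it is unique up to projective direct summands. For an integer $n\ge 0$, call $M$ $n$-torsionfree if $\operatorname{Ext}^j_R(\operatorname{Tr}M,R)=0$ for all $1\le j\le n$, and call $M$ totally reflexive if $\operatorname{Ext}^i_R(M,R)=0=\operatorname{Ext}^i_R(\operatorname{Tr}M,R)$ for all $i\ge 1$. Let $n\ge 0$ be an integer. If the $n$-torsionfree $R$-modules and the $(n+1)$-torsionfree $R$-modules coincide, then the $n$-torsionfree $R$-modules are exactly the totally reflexive $R$-modules. -/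

import Mathlib

open CategoryTheory

universe u

namespace AuslanderBridger

variable {R : Type u} [CommRing R]

/-- `T` is an (Auslander) transpose of `M`: there is an exact sequence
`P₁ --d--> P₀ --e--> M --> 0` with `P₀`, `P₁` finitely generated projective, such that `T` is
isomorphic to the cokernel of the `R`-dual `d^* : Hom(P₀, R) → Hom(P₁, R)`. -/
def IsTranspose (M T : ModuleCat.{u} R) : Prop :=
  ∃ (P₁ P₀ : ModuleCat.{u} R) (d : P₁ →ₗ[R] P₀) (e : P₀ →ₗ[R] M),
    Module.Finite R P₁ ∧ Module.Projective R P₁ ∧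
    Module.Finite R P₀ ∧ Module.Projective R P₀ ∧
    Function.Exact d e ∧ Function.Surjective e ∧
    Nonempty (T ≃ₗ[R] (Module.Dual R P₁ ⧸ LinearMap.range d.dualMap))

/-- `Ext^i_R(M, R) = 0` for all integers `i` with `1 ≤ i ≤ a`, where `a` may be infinite. -/
def ExtVanishes (M : ModuleCat.{u} R) (a : ℕ∞) : Prop :=
  ∀ i : ℕ, 1 ≤ i → (i : ℕ∞) ≤ a → Subsingleton (Abelian.Ext M (ModuleCat.of R R) i)

variable (R)

/-- The full subcategory `𝒢_{a,b}` of finitely generated `R`-modules `M` with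
`Ext^i_R(M, R) = 0` for `1 ≤ i ≤ a` and `Ext^j_R(Tr M, R) = 0` for `1 ≤ j ≤ b`. Transposes of `M`
agree up to projective direct summands, so that the second condition does not depend on the
chosen transpose. -/
def GSubcat (a b : ℕ∞) : ObjectProperty (ModuleCat.{u} R) := fun M =>
  Module.Finite R M ∧ ExtVanishes M a ∧ ∃ T : ModuleCat.{u} R, IsTranspose M T ∧ ExtVanishes T b

/-- The full subcategory of `n`-torsionfree modules. -/
def TF (n : ℕ) : ObjectProperty (ModuleCat.{u} R) := GSubcat R 0 n

/-- The full subcategory of totally reflexive modules. -/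
def GP : ObjectProperty (ModuleCat.{u} R) := GSubcat R ⊤ ⊤

end AuslanderBridger

/-!
Write `Eⁱ(X)` for `Ext^i_R(X, R)`. Two elementary facts about transposes carry the proof.

* Transposition is symmetric: dualizing a presentation `P₁ → P₀ → M` of `M` gives a presentation
  `P₀^* → P₁^* → T` of `T = Tr M`, whose transpose is `M` again because finitely generated
  projectives are reflexive (`IsTranspose.symm`). Moreover the vanishing of `Eⁱ(Tr M)`, `i ≥ 1`, does
  not depend on the chosen transpose (`IsTranspose.subsingleton_ext`).
* If `E¹(N) = 0`, then a syzygy `K` of `N` has a transpose `T'` in a short exact sequence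
  `0 → Tr N → P₂^* → T' → 0`, so that `Eⁱ(Tr N) = Eⁱ⁺¹(T')` for `i ≥ 1`, while `E¹(T') = 0`
  (`IsTranspose.exists_syzygy`).

By symmetry the hypothesis says that `E¹(N) = ⋯ = Eⁿ(N) = 0` implies `Eⁿ⁺¹(N) = 0`. Then the
syzygies of such an `N` satisfy the same condition, so `Eⁱ(N) = 0` for all `i ≥ 1`
(`extVanishes_top_of_step`).

Now let `N` satisfy `Eⁱ(N) = 0` for all `i ≥ 1`. So do its syzygies, and each syzygy gains one
vanishing `Eʲ` of the transpose. After `n` steps the transpose satisfies `E¹ = ⋯ = Eⁿ = 0`, hence all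
its `Eʲ` vanish, and the isomorphisms `Eʲ(Tr N) = Eʲ⁺¹(Tr K)` carry this back to `Tr N`
(`extVanishes_top_of_transpose`). For an `n`-torsionfree `M` the first part applied to `Tr M` and the
second part applied to `N = Tr M`, whose transpose is `M`, show that `M` is totally reflexive.
-/

namespace AuslanderBridger

open Abelian Function

variable {R : Type u} [CommRing R]

/-! ### Factoring linear maps through exact sequences -/

section Factorization

variable {A B C X : Type*} [AddCommGroup A] [AddCommGroup B] [AddCommGroup C] [AddCommGroup X]
  [Module R A] [Module R B] [Module R C] [Module R X]

lemma exists_desc_of_exact {f : A →ₗ[R] B} {g : B →ₗ[R] C} (hfg : Exact f g)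
    (hg : Surjective g) (φ : B →ₗ[R] X) (hφ : φ ∘ₗ f = 0) : ∃ ψ : C →ₗ[R] X, ψ ∘ₗ g = φ := by
  have hle : LinearMap.range f ≤ LinearMap.ker φ := by
    rintro _ ⟨x, rfl⟩
    exact LinearMap.congr_fun hφ x
  refine ⟨(LinearMap.range f).liftQ φ hle ∘ₗ (hfg.linearEquivOfSurjective hg).symm, ?_⟩
  ext x
  have : (hfg.linearEquivOfSurjective hg).symm (g x) = Submodule.Quotient.mk x := by
    rw [LinearEquiv.symm_apply_eq]
    rfl
  simp [this]

lemma exists_lift_of_exact [Module.Projective R X] {f : A →ₗ[R] B} {g : B →ₗ[R] C}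
    (hfg : Exact f g) (φ : X →ₗ[R] B) (hφ : g ∘ₗ φ = 0) : ∃ ψ : X →ₗ[R] A, f ∘ₗ ψ = φ := by
  have hmem : ∀ x, φ x ∈ LinearMap.range f := fun x => (hfg _).1 (LinearMap.congr_fun hφ x)
  obtain ⟨ψ, hψ⟩ := Module.projective_lifting_property f.rangeRestrict
    (φ.codRestrict _ hmem) f.surjective_rangeRestrict
  refine ⟨ψ, ?_⟩
  ext x
  exact congrArg Subtype.val (LinearMap.congr_fun hψ x)

end Factorization

/-! ### Dimension shifting -/

section DimensionShift

variable {A P B : ModuleCat.{u} R} {f : A →ₗ[R] P} {g : P →ₗ[R] B}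

lemma subsingleton_ext_succ_iff [Module.Projective R P] (hf : Injective f) (hg : Surjective g)
    (hfg : Exact f g) (Y : ModuleCat.{u} R) (i : ℕ) :
    Subsingleton (Ext A Y (i + 1)) ↔ Subsingleton (Ext B Y (i + 2)) := by
  let S : ShortComplex (ModuleCat.{u} R) :=
    ShortComplex.mk (ModuleCat.ofHom f) (ModuleCat.ofHom g)
      (by ext x; exact hfg.apply_apply_eq_zero x)
  have hS : S.ShortExact := ModuleCat.shortComplex_shortExact S hfg hf hg
  have hP : CategoryTheory.Projective S.X₂ :=
    inferInstanceAs (CategoryTheory.Projective P)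
  constructor
  · intro h
    refine subsingleton_of_forall_eq 0 fun x => ?_
    obtain ⟨y, rfl⟩ := Ext.contravariant_sequence_exact₃ hS Y x
      (Ext.eq_zero_of_projective _) (add_comm 1 (i + 1))
    rw [show y = 0 from h.elim _ _, Ext.comp_zero]
  · intro h
    refine subsingleton_of_forall_eq 0 fun x => ?_
    obtain ⟨y, rfl⟩ := Ext.contravariant_sequence_exact₁ hS Y x (add_comm 1 (i + 1))
      (h.elim _ _)
    rw [Ext.eq_zero_of_projective y, Ext.comp_zero]

lemma subsingleton_ext_one_iff [Module.Projective R P] (hf : Injective f) (hg : Surjective g)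
    (hfg : Exact f g) (Y : ModuleCat.{u} R) :
    Subsingleton (Ext B Y 1) ↔ ∀ φ : A →ₗ[R] Y, ∃ ψ : P →ₗ[R] Y, ψ ∘ₗ f = φ := by
  let S : ShortComplex (ModuleCat.{u} R) :=
    ShortComplex.mk (ModuleCat.ofHom f) (ModuleCat.ofHom g)
      (by ext x; exact hfg.apply_apply_eq_zero x)
  have hS : S.ShortExact := ModuleCat.shortComplex_shortExact S hfg hf hg
  have hP : CategoryTheory.Projective S.X₂ :=
    inferInstanceAs (CategoryTheory.Projective P)
  constructor
  · intro h φ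
    obtain ⟨y, hy⟩ := Ext.contravariant_sequence_exact₁ hS Y (Ext.mk₀ (ModuleCat.ofHom φ))
      (add_comm 1 0) (h.elim _ _)
    obtain ⟨ψ, rfl⟩ := (Ext.mk₀_bijective _ _).2 y
    rw [Ext.mk₀_comp_mk₀] at hy
    exact ⟨ψ.hom, congrArg ModuleCat.Hom.hom ((Ext.mk₀_bijective _ _).1 hy)⟩
  · intro h
    refine subsingleton_of_forall_eq 0 fun x => ?_
    obtain ⟨y, rfl⟩ := Ext.contravariant_sequence_exact₃ hS Y x
      (Ext.eq_zero_of_projective _) (add_comm 1 0)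
    obtain ⟨φ, rfl⟩ := (Ext.mk₀_bijective _ _).2 y
    obtain ⟨ψ, hψ⟩ := h φ.hom
    have hφ : φ = S.f ≫ ModuleCat.ofHom ψ := ModuleCat.hom_ext hψ.symm
    rw [hφ, ← Ext.mk₀_comp_mk₀, hS.extClass_comp_assoc]

end DimensionShift

/-- Higher `Ext` does not see maps factoring through a projective module, so its vanishing passes
to stable retracts. -/
lemma subsingleton_ext_of_stable_retract {T T' Q Y : ModuleCat.{u} R} [Module.Projective R Q]
    (v : T →ₗ[R] T') (u : T' →ₗ[R] T) (t : T →ₗ[R] Q) (p : Q →ₗ[R] T)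
    (huv : u ∘ₗ v + p ∘ₗ t = LinearMap.id) (i : ℕ) (h : Subsingleton (Ext T' Y (i + 1))) :
    Subsingleton (Ext T Y (i + 1)) := by
  refine subsingleton_of_forall_eq 0 fun x => ?_
  have hid : 𝟙 T = ModuleCat.ofHom v ≫ ModuleCat.ofHom u + ModuleCat.ofHom t ≫ ModuleCat.ofHom p :=
    ModuleCat.hom_ext huv.symm
  rw [← Ext.mk₀_id_comp x, hid, Ext.mk₀_add, Ext.add_comp, ← Ext.mk₀_comp_mk₀_assoc,
    ← Ext.mk₀_comp_mk₀_assoc, h.elim ((Ext.mk₀ (ModuleCat.ofHom u)).comp x _) 0,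
    Ext.eq_zero_of_projective ((Ext.mk₀ (ModuleCat.ofHom p)).comp x _), Ext.comp_zero,
    Ext.comp_zero, add_zero]

/-! ### Transposes -/

lemma isTranspose_of_exact {M T P₁ P₀ : ModuleCat.{u} R} [Module.Finite R P₁]
    [Module.Projective R P₁] [Module.Finite R P₀] [Module.Projective R P₀]
    {d : P₁ →ₗ[R] P₀} {e : P₀ →ₗ[R] M} (hde : Exact d e) (he : Surjective e)
    {π : Module.Dual R P₁ →ₗ[R] T} (hπ : Exact d.dualMap π) (hπ' : Surjective π) :
    IsTranspose M T :=
  ⟨P₁, P₀, d, e, ‹_›, ‹_›, ‹_›, ‹_›, hde, he, ⟨(hπ.linearEquivOfSurjective hπ').symm⟩⟩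

lemma IsTranspose.exists_exact {M T : ModuleCat.{u} R} (h : IsTranspose M T) :
    ∃ (P₁ P₀ : ModuleCat.{u} R) (d : P₁ →ₗ[R] P₀) (e : P₀ →ₗ[R] M)
      (π : Module.Dual R P₁ →ₗ[R] T),
      Module.Finite R P₁ ∧ Module.Projective R P₁ ∧ Module.Finite R P₀ ∧ Module.Projective R P₀ ∧
      Exact d e ∧ Surjective e ∧ Exact d.dualMap π ∧ Surjective π := by
  obtain ⟨P₁, P₀, d, e, h₁, h₂, h₃, h₄, hde, he, ⟨E⟩⟩ := h
  refine ⟨P₁, P₀, d, e, E.symm.toLinearMap ∘ₗ (LinearMap.range d.dualMap).mkQ,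
    h₁, h₂, h₃, h₄, hde, he, ?_, E.symm.surjective.comp (Submodule.mkQ_surjective _)⟩
  intro x
  simp

lemma IsTranspose.finite {M T : ModuleCat.{u} R} (h : IsTranspose M T) : Module.Finite R T := by
  obtain ⟨P₁, P₀, d, e, π, _, _, _, _, _, _, _, hπ⟩ := h.exists_exact
  exact Module.Finite.of_surjective π hπ

lemma exists_isTranspose [IsNoetherianRing R] (M : ModuleCat.{u} R) [Module.Finite R M] :
    ∃ T : ModuleCat.{u} R, IsTranspose M T := by
  obtain ⟨m, e, he⟩ := Module.Finite.exists_fin' R M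
  obtain ⟨k, c, hc⟩ := Module.Finite.exists_fin' R (LinearMap.ker e)
  refine ⟨ModuleCat.of R (Module.Dual R (Fin k → R) ⧸
    LinearMap.range ((LinearMap.ker e).subtype ∘ₗ c).dualMap),
    ModuleCat.of R (Fin k → R), ModuleCat.of R (Fin m → R), (LinearMap.ker e).subtype ∘ₗ c, e,
    inferInstanceAs (Module.Finite R (Fin k → R)),
    inferInstanceAs (Module.Projective R (Fin k → R)),
    inferInstanceAs (Module.Finite R (Fin m → R)),
    inferInstanceAs (Module.Projective R (Fin m → R)), ?_, he, ⟨LinearEquiv.refl _ _⟩⟩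
  rw [LinearMap.exact_iff, LinearMap.range_comp, LinearMap.range_eq_top.2 hc, Submodule.map_top,
    Submodule.range_subtype]

/-- Transposition is symmetric: the dual of a presentation of `M` presents its transpose, and the
double dual of the presentation is the presentation itself. -/
lemma IsTranspose.symm {M T : ModuleCat.{u} R} (h : IsTranspose M T) : IsTranspose T M := by
  obtain ⟨P₁, P₀, d, e, π, _, _, _, _, hde, he, hdπ, hπ⟩ := h.exists_exact
  have hnat : ∀ x : P₁, d.dualMap.dualMap (Module.evalEquiv R P₁ x) = Module.evalEquiv R P₀ (d x) :=
    fun x => rfl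
  refine isTranspose_of_exact (P₁ := ModuleCat.of R (Module.Dual R P₀))
    (P₀ := ModuleCat.of R (Module.Dual R P₁)) (d := d.dualMap) (e := π)
    (π := e ∘ₗ (Module.evalEquiv R P₀).symm.toLinearMap) hdπ hπ ?_
    (he.comp (Module.evalEquiv R P₀).symm.surjective)
  intro y
  obtain ⟨x, rfl⟩ := (Module.evalEquiv R P₀).surjective y
  simp only [LinearMap.comp_apply, LinearEquiv.coe_coe, LinearEquiv.symm_apply_apply]
  rw [hde x]
  constructor
  · rintro ⟨z, rfl⟩
    exact ⟨_, hnat z⟩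
  · rintro ⟨w, hw⟩
    obtain ⟨z, rfl⟩ := (Module.evalEquiv R P₁).surjective w
    exact ⟨z, (Module.evalEquiv R P₀).injective ((hnat z).symm.trans hw)⟩

/-- Two transposes of `M` are stable retracts of each other, by comparing presentations of `M`, so
they have the same vanishing higher `Ext` modules. -/
lemma IsTranspose.subsingleton_ext {M T T' : ModuleCat.{u} R} (hT : IsTranspose M T)
    (hT' : IsTranspose M T') (Y : ModuleCat.{u} R) (i : ℕ)
    (h : Subsingleton (Ext T' Y (i + 1))) : Subsingleton (Ext T Y (i + 1)) := by
  obtain ⟨P₁, P₀, d, e, π, _, _, _, _, hde, he, hdπ, hπ⟩ := hT.exists_exact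
  obtain ⟨P₁', P₀', d', e', π', _, _, _, _, hde', he', hdπ', hπ'⟩ := hT'.exists_exact
  have hed := hde.linearMap_comp_eq_zero
  have hed' := hde'.linearMap_comp_eq_zero
  -- Lift the identity of `M` to chain maps `a`, `b` between the two presentations.
  obtain ⟨a₀, ha₀⟩ := Module.projective_lifting_property e' e he'
  obtain ⟨b₀, hb₀⟩ := Module.projective_lifting_property e e' he
  obtain ⟨a₁, ha₁⟩ := exists_lift_of_exact hde' (a₀ ∘ₗ d)
    (by rw [← LinearMap.comp_assoc, ha₀, hed])
  obtain ⟨b₁, hb₁⟩ := exists_lift_of_exact hde (b₀ ∘ₗ d')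
    (by rw [← LinearMap.comp_assoc, hb₀, hed'])
  -- In degree `0` the composite `b ∘ a` differs from the identity by `d ∘ s`.
  obtain ⟨s, hs⟩ := exists_lift_of_exact hde (b₀ ∘ₗ a₀ - LinearMap.id)
    (by rw [LinearMap.comp_sub, ← LinearMap.comp_assoc, hb₀, ha₀, LinearMap.comp_id, sub_self])
  -- In degree `1` the remaining error `r` has its values in the kernel of `d`, so that its dual
  -- factors through `T`.
  set r : P₁ →ₗ[R] P₁ := b₁ ∘ₗ a₁ - LinearMap.id - s ∘ₗ d with hr
  have hdr : d ∘ₗ r = 0 := by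
    rw [hr, LinearMap.comp_sub, LinearMap.comp_sub, ← LinearMap.comp_assoc, hb₁,
      LinearMap.comp_assoc, ha₁, ← LinearMap.comp_assoc, ← LinearMap.comp_assoc, hs,
      LinearMap.sub_comp, LinearMap.comp_id, LinearMap.id_comp, sub_self]
  obtain ⟨u, hu⟩ := exists_desc_of_exact hdπ' hπ' (π ∘ₗ a₁.dualMap) (by
    rw [LinearMap.comp_assoc, LinearMap.dualMap_comp_dualMap, ha₁, ← LinearMap.dualMap_comp_dualMap,
      ← LinearMap.comp_assoc, hdπ.linearMap_comp_eq_zero, LinearMap.zero_comp])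
  obtain ⟨v, hv⟩ := exists_desc_of_exact hdπ hπ (π' ∘ₗ b₁.dualMap) (by
    rw [LinearMap.comp_assoc, LinearMap.dualMap_comp_dualMap, hb₁, ← LinearMap.dualMap_comp_dualMap,
      ← LinearMap.comp_assoc, hdπ'.linearMap_comp_eq_zero, LinearMap.zero_comp])
  obtain ⟨t, ht⟩ := exists_desc_of_exact hdπ hπ r.dualMap (by
    rw [LinearMap.dualMap_comp_dualMap, hdr]
    exact LinearMap.ext fun x => x.comp_zero)
  refine subsingleton_ext_of_stable_retract (Q := ModuleCat.of R (Module.Dual R P₁)) v u t (-π)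
    ?_ i h
  ext y
  obtain ⟨x, rfl⟩ := hπ y
  have hv' : v (π x) = π' (b₁.dualMap x) := LinearMap.congr_fun hv x
  have hu' : u (π' (b₁.dualMap x)) = π (a₁.dualMap (b₁.dualMap x)) := LinearMap.congr_fun hu _
  have ht' : t (π x) = r.dualMap x := LinearMap.congr_fun ht x
  have hsum : a₁.dualMap (b₁.dualMap x) = x + r.dualMap x + d.dualMap (s.dualMap x) := by
    ext z
    simp [hr]
    abel
  simp only [LinearMap.add_apply, LinearMap.comp_apply, LinearMap.neg_apply, hv', hu', ht', hsum,
    map_add, hdπ.apply_apply_eq_zero, LinearMap.id_apply]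
  abel

/-! ### Transposes of syzygies -/

/-- If `Ext¹(N, R) = 0`, then dualizing `P₂ → P₁ → P₀ → N → 0` gives a short exact sequence
`0 → T → P₂^* → T' → 0` between the transpose `T` of `N` and the transpose `T'` of the syzygy `K` of
`N`; exactness on the left is the vanishing of `Ext¹(N, R)`. The vanishing of `Ext¹(T', R)` holds
because a syzygy is torsionless. -/
lemma IsTranspose.exists_syzygy [IsNoetherianRing R] {N T : ModuleCat.{u} R}
    (h : IsTranspose N T) (hN : Subsingleton (Ext N (ModuleCat.of R R) 1)) :
    ∃ K T' : ModuleCat.{u} R, Module.Finite R K ∧ IsTranspose K T' ∧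
      Subsingleton (Ext T' (ModuleCat.of R R) 1) ∧
      (∀ i, Subsingleton (Ext K (ModuleCat.of R R) (i + 1)) ↔
        Subsingleton (Ext N (ModuleCat.of R R) (i + 2))) ∧
      (∀ i, Subsingleton (Ext T (ModuleCat.of R R) (i + 1)) ↔
        Subsingleton (Ext T' (ModuleCat.of R R) (i + 2))) := by
  obtain ⟨P₁, P₀, d, e, π, _, _, _, _, hde, he, hdπ, hπ⟩ := h.exists_exact
  obtain ⟨k, c, hc⟩ := Module.Finite.exists_fin' R (LinearMap.ker d)
  let P₂ : ModuleCat.{u} R := ModuleCat.of R (Fin k → R)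
  have : Module.Finite R P₂ := inferInstanceAs (Module.Finite R (Fin k → R))
  have : Module.Projective R P₂ := inferInstanceAs (Module.Projective R (Fin k → R))
  let d₂ : P₂ →ₗ[R] P₁ := (LinearMap.ker d).subtype ∘ₗ c
  have hd₂ : Exact d₂ d := by
    rw [LinearMap.exact_iff, LinearMap.range_comp, LinearMap.range_eq_top.2 hc, Submodule.map_top,
      Submodule.range_subtype]
  let K : ModuleCat.{u} R := ModuleCat.of R (LinearMap.range d)
  let T' : ModuleCat.{u} R := ModuleCat.of R (Module.Dual R P₂ ⧸ LinearMap.range d₂.dualMap)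
  let j : K →ₗ[R] P₀ := (LinearMap.range d).subtype
  have hj : Injective j := Subtype.val_injective
  have hje : Exact j e := by
    rw [LinearMap.exact_iff, hde.linearMap_ker_eq]
    exact (Submodule.range_subtype _).symm
  let q : P₁ →ₗ[R] K := d.rangeRestrict
  have hq : Surjective q := d.surjective_rangeRestrict
  have hd₂q : Exact d₂ q := by
    rw [LinearMap.exact_iff, ← hd₂.linearMap_ker_eq]
    exact d.ker_rangeRestrict
  let π₂ : Module.Dual R P₂ →ₗ[R] T' := (LinearMap.range d₂.dualMap).mkQ
  have hπ₂ : Surjective π₂ := Submodule.mkQ_surjective _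
  have hd₂π₂ : Exact d₂.dualMap π₂ := by
    rw [LinearMap.exact_iff]
    exact Submodule.ker_mkQ _
  obtain ⟨ι, hι⟩ := exists_desc_of_exact hdπ hπ d₂.dualMap (by
    rw [LinearMap.dualMap_comp_dualMap, hd₂.linearMap_comp_eq_zero]
    exact LinearMap.ext fun x => x.comp_zero)
  have hιπ : ∀ x, ι (π x) = d₂.dualMap x := LinearMap.congr_fun hι
  have hι_inj : Injective ι := by
    rw [injective_iff_map_eq_zero]
    intro y hy
    obtain ⟨x, rfl⟩ := hπ y
    rw [hιπ] at hy
    obtain ⟨φ, hφ⟩ := exists_desc_of_exact hd₂q hq x hy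
    obtain ⟨ψ, hψ⟩ := (subsingleton_ext_one_iff hj he hje (ModuleCat.of R R)).1 hN φ
    refine (hdπ x).2 ⟨ψ, ?_⟩
    rw [← hφ, ← hψ]
    rfl
  have hιπ₂ : Exact ι π₂ := by
    intro z
    rw [hd₂π₂ z]
    constructor
    · rintro ⟨x, rfl⟩
      exact ⟨π x, hιπ x⟩
    · rintro ⟨y, rfl⟩
      obtain ⟨x, rfl⟩ := hπ y
      exact ⟨x, (hιπ x).symm⟩
  refine ⟨K, T', Module.Finite.of_surjective q hq, isTranspose_of_exact hd₂q hq hd₂π₂ hπ₂, ?_,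
    subsingleton_ext_succ_iff hj he hje _,
    subsingleton_ext_succ_iff (P := ModuleCat.of R (Module.Dual R P₂)) hι_inj hπ₂ hιπ₂ _⟩
  rw [subsingleton_ext_one_iff (P := ModuleCat.of R (Module.Dual R P₂)) hι_inj hπ₂ hιπ₂]
  intro φ
  -- By reflexivity of `P₁`, the map `φ ∘ π` is evaluation at some `p`, which `d` kills because
  -- `φ ∘ π` vanishes on the image of the dual of `d`. Hence `p` comes from `P₂`.
  obtain ⟨p, hp⟩ := (Module.evalEquiv R P₁).surjective (φ ∘ₗ π)
  have hp' : ∀ x : Module.Dual R P₁, x p = φ (π x) := LinearMap.congr_fun hp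
  have hdp : d p = 0 := by
    refine (Module.forall_dual_apply_eq_zero_iff R (d p)).1 fun y => ?_
    have := hp' (d.dualMap y)
    rwa [hdπ.apply_apply_eq_zero, map_zero] at this
  obtain ⟨z, rfl⟩ := (hd₂ p).1 hdp
  refine ⟨Module.Dual.eval R P₂ z, ?_⟩
  ext y
  obtain ⟨x, rfl⟩ := hπ y
  rw [LinearMap.comp_apply, hιπ]
  exact hp' x

/-! ### Total reflexivity -/

lemma ExtVanishes.mono {M : ModuleCat.{u} R} {a b : ℕ∞} (h : ExtVanishes M b) (hab : a ≤ b) :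
    ExtVanishes M a :=
  fun i hi hia => h i hi (hia.trans hab)

lemma extVanishes_zero (M : ModuleCat.{u} R) : ExtVanishes M 0 := by
  intro i hi hi0
  have : i ≤ 0 := by exact_mod_cast hi0
  omega

lemma extVanishes_top_of_forall {M : ModuleCat.{u} R} (h : ∀ k : ℕ, ExtVanishes M k) :
    ExtVanishes M ⊤ :=
  fun i hi _ => h i i hi le_rfl

/-- Shifting the vanishing range up by one along isomorphisms `Extⁱ(K, R) = Extⁱ⁺¹(N, R)`. -/
lemma extVanishes_succ_iff {K N : ModuleCat.{u} R}
    (hKN : ∀ i, Subsingleton (Ext K (ModuleCat.of R R) (i + 1)) ↔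
      Subsingleton (Ext N (ModuleCat.of R R) (i + 2))) (k : ℕ) :
    ExtVanishes N (k + 1 : ℕ) ↔
      Subsingleton (Ext N (ModuleCat.of R R) 1) ∧ ExtVanishes K k := by
  constructor
  · intro h
    refine ⟨h 1 le_rfl (by exact_mod_cast Nat.succ_pos k), fun i hi hik => ?_⟩
    have hik' : i ≤ k := by exact_mod_cast hik
    obtain ⟨i, rfl⟩ := Nat.exists_eq_add_of_le' hi
    exact (hKN i).2 (h (i + 2) (by omega) (by exact_mod_cast (by omega : i + 2 ≤ k + 1)))
  · rintro ⟨h1, h⟩ i hi hik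
    have hik' : i ≤ k + 1 := by exact_mod_cast hik
    match i, hi with
    | 1, _ => exact h1
    | i + 2, _ => exact (hKN i).1 (h (i + 1) (by omega) (by exact_mod_cast (by omega : i + 1 ≤ k)))

variable [IsNoetherianRing R] {n : ℕ}

/-- If `Ext¹, …, Extⁿ` vanishing always forces `Extⁿ⁺¹` to vanish, then it forces all higher `Ext`
to vanish, because a syzygy satisfies the condition again. -/
lemma extVanishes_top_of_step
    (hstep : ∀ N : ModuleCat.{u} R, Module.Finite R N → ExtVanishes N n →
      ExtVanishes N (n + 1 : ℕ))
    (N : ModuleCat.{u} R) [hfin : Module.Finite R N] (hN : ExtVanishes N n) :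
    ExtVanishes N ⊤ := by
  refine extVanishes_top_of_forall fun k => ?_
  induction k generalizing N with
  | zero => exact extVanishes_zero N
  | succ k ih =>
    obtain ⟨T, hT⟩ := exists_isTranspose N
    have hN' := hstep N hfin hN
    have hN1 := hN' 1 le_rfl (by exact_mod_cast Nat.succ_pos n)
    obtain ⟨K, _, _, _, _, hK, _⟩ := hT.exists_syzygy hN1
    exact (extVanishes_succ_iff hK k).2 ⟨hN1, ih K ((extVanishes_succ_iff hK n).1 hN').2⟩

/-- Passing to a syzygy `m` times brings `T`, for which `b` vanishings of `Ext` are known, to a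
module satisfying `Ext¹ = ⋯ = Extⁿ = 0`; the resulting vanishing descends back to `T`. -/
lemma extVanishes_top_of_transpose
    (htop : ∀ N : ModuleCat.{u} R, Module.Finite R N → ExtVanishes N n → ExtVanishes N ⊤)
    (m b : ℕ) (hmb : n ≤ b + m) (N T : ModuleCat.{u} R) (hT : IsTranspose N T)
    (hN : ExtVanishes N ⊤) (hTb : ExtVanishes T b) : ExtVanishes T ⊤ := by
  induction m generalizing b N T with
  | zero => exact htop T hT.finite (hTb.mono (by exact_mod_cast hmb))
  | succ m ih =>
    obtain ⟨K, T', _, hKT', hT'1, hK, hT'⟩ := hT.exists_syzygy (hN 1 le_rfl le_top)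
    have hKtop : ExtVanishes K ⊤ := extVanishes_top_of_forall fun k =>
      ((extVanishes_succ_iff hK k).1 (hN.mono le_top)).2
    have hT'top := ih (b + 1) (by omega) K T' hKT' hKtop
      ((extVanishes_succ_iff hT' b).2 ⟨hT'1, hTb⟩)
    exact extVanishes_top_of_forall fun k =>
      ((extVanishes_succ_iff hT' k).1 (hT'top.mono le_top)).2

end AuslanderBridger

open AuslanderBridger in
theorem corollary5p8 (R : Type u) [CommRing R] [IsNoetherianRing R] (n : ℕ)
    (h : AuslanderBridger.TF R n = AuslanderBridger.TF R (n + 1)) :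
    AuslanderBridger.TF R n = AuslanderBridger.GP R := by
  have hstep : ∀ N : ModuleCat.{u} R, Module.Finite R N → ExtVanishes N n →
      ExtVanishes N (n + 1 : ℕ) := by
    intro N _ hN
    obtain ⟨T, hT⟩ := exists_isTranspose N
    have hTF : TF R n T := ⟨hT.finite, extVanishes_zero T, N, hT.symm, hN⟩
    rw [h] at hTF
    obtain ⟨-, -, N', hN', hvan⟩ := hTF
    intro i hi hin
    obtain ⟨i, rfl⟩ := Nat.exists_eq_add_of_le' hi
    exact hT.symm.subsingleton_ext hN' _ i (hvan _ hi hin)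
  have htop : ∀ N : ModuleCat.{u} R, Module.Finite R N → ExtVanishes N n → ExtVanishes N ⊤ :=
    fun N _ hN => extVanishes_top_of_step hstep N hN
  ext M
  constructor
  · rintro ⟨hM, hM0, T, hMT, hT⟩
    have hTtop := htop T hMT.finite hT
    exact ⟨hM, extVanishes_top_of_transpose htop n 0 (by omega) T M hMT.symm hTtop hM0, T, hMT,
      hTtop⟩
  · rintro ⟨hM, -, T, hMT, hT⟩
    exact ⟨hM, extVanishes_zero M, T, hMT, hT.mono le_top⟩
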